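/- Let $k$ be a field of characteristic $0$ and let $G$ be a finite group, regarded as a finite constant group scheme over $k$. Let $\mathrm{Sm}/k$ be the category of separated smooth $k$-schemes and $G\mathrm{Sm}/k$ the category of separated smooth $k$-schemes with a $G$-action and $G$-equivariant $k$-morphisms. For $X\in G\mathrm{Sm}/k$ and a subgroup $H\le G$, let $X^H$ denote the $k$-scheme of $H$-fixed points, i.e. the $k$-scheme representing the functor $T\mapsto \mathrm{Hom}_H(T_{\mathrm{tr}},X)$, where $T_{\mathrm{tr}}$ is the $k$-scheme $T$ with trivial $H$-action; an equivariant morphism $f:X\to Y$ induces $f^H:X^H\to Y^H$. A morphism $f:X\to Y$ in $G\mathrm{Sm}/k$ is an *equivariant Nisnevich cover* if it is étale and there is a finite sequence of $G$-invariant closed subvarieties (closed subsets with reduced scheme structure) $$\emptyset=Y_{n}\subsetneq Y_{n-1}\subsetneq\cdots\subsetneq Y_0=Y$$ such that for every $0\le j<n$ there is a $G$-equivariant section of $f$ over $Y_j\setminus Y_{j+1}$, i.e. a $G$-equivariant morphism $s_j:Y_j\setminus Y_{j+1}\to X$ such that $f\circ s_j$ is the inclusion into $Y$. A morphism $f:X\to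 Y$ in $G\mathrm{Sm}/k$ is an *$H$-cover* (a cover in the fixed-point Nisnevich, or $H$-Nisnevich, topology) if for every subgroup $H\le G$ the morphism $f^H:X^H\to Y^H$ is an ordinary Nisnevich covering in $\mathrm{Sm}/k$; that is, $X^H$ and $Y^H$ are smooth and separated over $k$, $f^H$ is étale, and for every point $y\in Y^H$ there is a point $x\in X^H$ with $f^H(x)=y$ such that $f^H$ induces an isomorphism of residue fields $\kappa(y)\to\kappa(x)$. **Corollary.** Every equivariant Nisnevich cover in $G\mathrm{Sm}/k$ is an $H$-cover. -/

import Mathlib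

open CategoryTheory Limits AlgebraicGeometry

universe u v

noncomputable section

namespace EquivariantNisnevich

/-- The category of schemes over the field `k`. -/
abbrev Sch (k : Type u) [Field k] : Type (u + 1) := Over (Spec (CommRingCat.of k))

/-- The category of `k`-schemes with an action of the finite constant group `G`: an object is a
`k`-scheme `X.V` with a homomorphism `X.ρ` from `G` to its `k`-endomorphisms (composition of
endomorphisms being in function order, so that these are left actions), and morphisms are the
`G`-equivariant `k`-morphisms. -/
abbrev GSch (k : Type u) [Field k] (G : Type v) [Group G] := Action (Sch k) G

variable {k : Type u} [Field k] {G : Type v} [Group G]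

/-- The objects of `Sm/k`: smooth separated `k`-schemes. -/
structure IsSm (X : Sch k) : Prop where
  smooth : Smooth X.hom
  isSeparated : IsSeparated X.hom

/-- An ordinary Nisnevich covering in `Sm/k`: an étale morphism between smooth separated
`k`-schemes such that every point of the target is the image of a point of the source with the
same residue field. -/
structure IsNisnevichCover {X Y : Sch k} (f : X ⟶ Y) : Prop where
  source : IsSm X
  target : IsSm Y
  etale : Etale f.left
  exists_lift : ∀ y : Y.left, ∃ x : X.left, f.left x = y ∧ IsIso (f.left.residueFieldMap x)

section FixedPoints

variable [Finite G]

/-- The scheme `X^H` of `H`-fixed points of a `G`-scheme `X` over `k`: the equalizer of the two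
morphisms `(id)_h` and `(h)_h` from `X` to the product over `k` of copies of `X` indexed by
`h ∈ H`. It represents the functor `T ↦ Hom_H(T_tr, X)`, see `fixedPointsHomEquiv`. -/
def fixedPoints (H : Subgroup G) (X : GSch k G) : Sch k :=
  equalizer (Pi.lift fun _ : H => 𝟙 X.V) (Pi.lift fun h : H => (X.ρ h : X.V ⟶ X.V))

/-- The inclusion of `X^H` into `X`. -/
def fixedPointsι (H : Subgroup G) (X : GSch k G) : fixedPoints H X ⟶ X.V :=
  equalizer.ι _ _

instance (H : Subgroup G) (X : GSch k G) : Mono (fixedPointsι H X) :=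
  inferInstanceAs (Mono (equalizer.ι _ _))

theorem fixedPointsι_comp_ρ (H : Subgroup G) (X : GSch k G) (h : H) :
    fixedPointsι H X ≫ (X.ρ h : X.V ⟶ X.V) = fixedPointsι H X := by
  have e := equalizer.condition (Pi.lift fun _ : H => 𝟙 X.V)
    (Pi.lift fun h : H => (X.ρ h : X.V ⟶ X.V))
  have e' := congrArg (fun t => t ≫ Pi.π (fun _ : H => X.V) h) e
  simp only [Category.assoc, Pi.lift_π, Category.comp_id] at e'
  exact e'.symm

/-- A morphism to `X` that is invariant under `H` factors through `X^H`. -/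
def fixedPointsLift (H : Subgroup G) (X : GSch k G) {T : Sch k} (t : T ⟶ X.V)
    (ht : ∀ h : H, t ≫ (X.ρ h : X.V ⟶ X.V) = t) : T ⟶ fixedPoints H X :=
  equalizer.lift t (by
    refine Pi.hom_ext _ _ fun h => ?_
    simp [ht h])

theorem fixedPointsLift_ι (H : Subgroup G) (X : GSch k G) {T : Sch k} (t : T ⟶ X.V)
    (ht : ∀ h : H, t ≫ (X.ρ h : X.V ⟶ X.V) = t) :
    fixedPointsLift H X t ht ≫ fixedPointsι H X = t :=
  equalizer.lift_ι _ _

/-- `X^H` represents the functor sending a `k`-scheme `T` to the set of `H`-equivariant morphisms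
from `T` with the trivial action to `X` with the restricted action. -/
def fixedPointsHomEquiv (H : Subgroup G) (X : GSch k G) (T : Sch k) :
    (T ⟶ fixedPoints H X) ≃ (Action.trivial H T ⟶ (Action.res (Sch k) H.subtype).obj X) where
  toFun t :=
    { hom := t ≫ fixedPointsι H X
      comm := fun h => by
        have e : (t ≫ fixedPointsι H X) ≫ (X.ρ h : X.V ⟶ X.V) = t ≫ fixedPointsι H X := by
          rw [Category.assoc, fixedPointsι_comp_ρ]
        exact (Category.id_comp _).trans e.symm }
  invFun t := fixedPointsLift H X t.hom fun h => (t.comm h).symm.trans (Category.id_comp _)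
  left_inv t := by
    rw [← cancel_mono (fixedPointsι H X)]
    exact fixedPointsLift_ι _ _ _ _
  right_inv t := by
    ext1
    exact fixedPointsLift_ι _ _ _ _

/-- The morphism `f^H : X^H ⟶ Y^H` induced on fixed points by an equivariant `f : X ⟶ Y`. -/
def fixedPointsMap (H : Subgroup G) {X Y : GSch k G} (f : X ⟶ Y) :
    fixedPoints H X ⟶ fixedPoints H Y :=
  fixedPointsLift H Y (fixedPointsι H X ≫ f.hom) fun h => by
    have e : (X.ρ h : X.V ⟶ X.V) ≫ f.hom = f.hom ≫ (Y.ρ h : Y.V ⟶ Y.V) := f.comm h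
    rw [Category.assoc, ← e, ← Category.assoc, fixedPointsι_comp_ρ]

/-- A covering in the fixed-point Nisnevich topology (an `H`-cover): `f^H` is an ordinary
Nisnevich covering in `Sm/k` for all subgroups `H` of `G`. -/
def IsFixedPointNisnevichCover {X Y : GSch k G} (f : X ⟶ Y) : Prop :=
  ∀ H : Subgroup G, IsNisnevichCover (fixedPointsMap H f)

end FixedPoints

/-- `f : X ⟶ Y` has an equivariant section on the `G`-invariant locally closed subset `S` of `Y`.
Here `S` carries its reduced induced scheme structure and the induced action, that is, `S` is the
(essentially unique) reduced `G`-scheme `W` with an equivariant immersion `w : W ⟶ Y` of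
image `S`. -/
def HasEquivariantSectionOn {X Y : GSch k G} (f : X ⟶ Y) (S : Set Y.V.left) : Prop :=
  ∃ (W : GSch k G) (w : W ⟶ Y) (s : W ⟶ X), AlgebraicGeometry.IsReduced W.V.left ∧ IsImmersion w.hom.left ∧
    Set.range w.hom.left = S ∧ s ≫ f = w

/-- A covering in the equivariant Nisnevich topology: an étale equivariant morphism `f : X ⟶ Y`
for which there is a chain `Y = Z 0 ⊋ Z 1 ⊋ ⋯ ⊋ Z n = ∅` of `G`-invariant closed subvarieties
(equivalently, of `G`-invariant closed subsets, with their reduced structures) such that `f` has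
an equivariant section on each `Z i \ Z (i + 1)`. -/
structure IsEquivariantNisnevichCover {X Y : GSch k G} (f : X ⟶ Y) : Prop where
  etale : Etale f.hom.left
  exists_splitting : ∃ (n : ℕ) (Z : Fin (n + 1) → TopologicalSpace.Closeds Y.V.left),
    Z 0 = ⊤ ∧ Z (Fin.last n) = ⊥ ∧
    (∀ i : Fin n, Z i.succ < Z i.castSucc) ∧
    (∀ (i : Fin (n + 1)) (g : G), Set.MapsTo (Y.ρ g : Y.V ⟶ Y.V).left (Z i) (Z i)) ∧
    ∀ i : Fin n, HasEquivariantSectionOn f ((Z i.castSucc : Set Y.V.left) \ Z i.succ)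

end EquivariantNisnevich

end

/-! Smoothness of `X^H` comes from averaging. Since `X` is separated, `X^H` is closed in `X`, and
each fixed point has an `H`-invariant affine neighbourhood `Spec A`, in which `X^H` is `Spec B` with
`B` the largest quotient of `A` with trivial action. To lift `B → C/I` with `I² = 0`, lift `A → B →
C/I` to `A → C` by smoothness of `A` and average over `H`, whose order is invertible in
characteristic 0. The average is still a ring homomorphism because the translates agree modulo `I`;
being invariant, it factors through `B` (`Algebra.FormallySmooth.of_coinvariants`).

Étaleness of `f^H` needs no averaging: two morphisms to an unramified scheme agree on an open
subscheme (`exists_opens_equalizer`), so `X^H` is open in `X ×_Y Y^H`, which is étale over `Y^H`.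

For the residue fields, the image in `Y` of a point `y` of `Y^H` lies in some stratum. The resulting
`κ(y)`-point of the stratum is `H`-invariant, so the equivariant section carries it to a
`κ(y)`-point of `X^H` over `y`. -/

section Averaging

/-! ### Averaging lifts over a finite group of invertible order -/

variable {R A C : Type*} [CommRing R] [CommRing A] [CommRing C] [Algebra R A] [Algebra R C]

/-- The average of algebra homomorphisms that agree modulo a square-zero ideal is an algebra
homomorphism. -/
theorem AlgHom.exists_eq_smul_sum {ι : Type*} [Fintype ι] [Nonempty ι] {r : R}
    (hr : r * (Fintype.card ι : R) = 1) {I : Ideal C} (hI : I ^ 2 = ⊥)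
    (φ : ι → A →ₐ[R] C) (hφ : ∀ i j a, φ i a - φ j a ∈ I) :
    ∃ ψ : A →ₐ[R] C, ∀ a, ψ a = r • ∑ i, φ i a := by
  obtain ⟨o⟩ := ‹Nonempty ι›
  have hmul : ∀ x ∈ I, ∀ y ∈ I, x * y = 0 := fun x hx y hy => by
    have := Ideal.mul_mem_mul hx hy
    rwa [← sq, hI, Ideal.mem_bot] at this
  -- Relative to the base point `φ o`, the average is `φ o + D` with `D` a derivation into `I`; the
  -- error term `D a * D b` in multiplicativity vanishes as `I² = 0`.
  let D : A → C := fun a => r • ∑ i, (φ i a - φ o a)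
  have hD : ∀ a, r • ∑ i, φ i a = φ o a + D a := fun a => by
    simp only [D, Finset.sum_sub_distrib, smul_sub, Finset.sum_const, Finset.card_univ]
    rw [← Nat.cast_smul_eq_nsmul R, smul_smul, hr, one_smul]
    ring
  have hDI : ∀ a, D a ∈ I := fun a => by
    have : D a = algebraMap R C r * ∑ i, (φ i a - φ o a) := Algebra.smul_def _ _
    rw [this]
    exact I.mul_mem_left _ (I.sum_mem fun i _ => hφ i o a)
  have hDmul : ∀ a b, D (a * b) = φ o a * D b + D a * φ o b := fun a b => by
    have key : ∀ i, φ i (a * b) - φ o (a * b) =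
        φ o a * (φ i b - φ o b) + (φ i a - φ o a) * φ o b := fun i => by
      have := hmul _ (hφ i o a) _ (hφ i o b)
      rw [map_mul, map_mul]
      linear_combination this
    simp only [D, key, Finset.sum_add_distrib, ← Finset.mul_sum, ← Finset.sum_mul, smul_add,
      mul_smul_comm, smul_mul_assoc]
  refine ⟨AlgHom.ofLinearMap
    { toFun := fun a => r • ∑ i, φ i a
      map_add' := fun a b => by simp [Finset.sum_add_distrib]
      map_smul' := fun s a => by simp [← Finset.smul_sum, smul_comm r s] } ?_ ?_, fun a => rfl⟩
  · simp [← Nat.cast_smul_eq_nsmul R, smul_smul, hr]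
  · intro a b
    change r • ∑ i, φ i (a * b) = (r • ∑ i, φ i a) * (r • ∑ i, φ i b)
    rw [hD, hD, hD, hDmul, map_mul]
    linear_combination -hmul _ (hDI a) _ (hDI b)

end Averaging

/-- If a finite group `H` of invertible order acts on a formally smooth algebra `A`, then the
largest quotient `B` of `A` with trivial action is formally smooth. -/
theorem Algebra.FormallySmooth.of_coinvariants {R A B : Type u} [CommRing R] [CommRing A]
    [CommRing B] [Algebra R A] [Algebra R B] [Algebra.FormallySmooth R A]
    {H : Type*} [Group H] [Fintype H] (hH : IsUnit (Fintype.card H : R))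
    (σ : H → A →ₐ[R] A) (hσ : ∀ h h', (σ h).comp (σ h') = σ (h' * h))
    (p : A →ₐ[R] B) (hp : Function.Surjective p) (hpσ : ∀ h, p.comp (σ h) = p)
    (hlift : ∀ (C : Type u) [CommRing C] [Algebra R C] (ψ : A →ₐ[R] C),
      (∀ h, ψ.comp (σ h) = ψ) → ∃ θ : B →ₐ[R] C, θ.comp p = ψ) :
    Algebra.FormallySmooth R B := by
  refine .of_comp_surjective fun C _ _ I hI g => ?_
  obtain ⟨r, hr⟩ := hH.exists_left_inv
  obtain ⟨φ, hφ⟩ := Algebra.FormallySmooth.comp_surjective R A I hI (g.comp p)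
  have hφ' : ∀ h a, Ideal.Quotient.mk I (φ (σ h a)) = g (p a) := fun h a => by
    have h1 := DFunLike.congr_fun hφ (σ h a)
    have h2 := DFunLike.congr_fun (hpσ h) a
    simp only [AlgHom.comp_apply] at h1 h2
    rw [← h2, ← h1]
    rfl
  -- Every `φ ∘ σ h` lifts `g ∘ p`, because `p ∘ σ h = p`; hence they agree modulo `I`.
  obtain ⟨ψ, hψ⟩ := AlgHom.exists_eq_smul_sum hr hI (fun h => φ.comp (σ h)) fun i j a => by
    rw [← Ideal.Quotient.mk_eq_mk_iff_sub_mem]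
    exact (hφ' i a).trans (hφ' j a).symm
  obtain ⟨θ, hθ⟩ := hlift C ψ fun h => by
    ext a
    simp only [AlgHom.comp_apply, hψ]
    congr 1
    refine Fintype.sum_equiv (Equiv.mulLeft h) _ _ fun h' => ?_
    exact congrArg φ (DFunLike.congr_fun (hσ h' h) a)
  refine ⟨θ, ?_⟩
  rw [← AlgHom.cancel_right hp]
  ext a
  have h1 : θ (p a) = ψ a := DFunLike.congr_fun hθ a
  change Ideal.Quotient.mkₐ R I (θ (p a)) = g (p a)
  rw [h1, hψ, map_smul, map_sum]
  have : ∀ h, Ideal.Quotient.mkₐ R I ((φ.comp (σ h)) a) = g (p a) := fun h => hφ' h a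
  simp only [this, Finset.sum_const, Finset.card_univ, ← Nat.cast_smul_eq_nsmul R, smul_smul, hr,
    one_smul]

/-- The full subcategory of `P`-objects over `S` has a terminal object and pullbacks, both preserved
by the inclusion into `Over S`, so finite products formed there are products in `Over S`. -/
theorem CategoryTheory.MorphismProperty.pi_hom_mem {T : Type*} [Category* T]
    [HasFiniteLimits T] (P : MorphismProperty T)
    [P.ContainsIdentities] [P.IsStableUnderComposition] [P.IsStableUnderBaseChange]
    [P.HasOfPostcompProperty P] [P.RespectsIso] {S : T} {ι : Type*} [Finite ι]
    (X : ι → Over S) [HasProduct X] (hX : ∀ i, P (X i).hom) : P (∏ᶜ X).hom := by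
  let F := MorphismProperty.Over.forget P ⊤ S
  have : HasPullbacks (P.Over ⊤ S) := inferInstance
  have : HasTerminal (P.Over ⊤ S) := inferInstance
  have : HasFiniteLimits (P.Over ⊤ S) := hasFiniteLimits_of_hasTerminal_and_pullbacks
  have : PreservesFiniteLimits F := preservesFiniteLimits_of_preservesTerminal_and_pullbacks F
  let X' (i : ι) : P.Over ⊤ S := .mk ⊤ (X i).hom (hX i)
  have : HasProduct fun i => F.obj (X' i) := ‹HasProduct X›
  let e : F.obj (∏ᶜ X') ≅ ∏ᶜ X := PreservesProduct.iso F X'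
  have h : P (F.obj (∏ᶜ X')).hom := (∏ᶜ X').prop
  have : IsIso ((CategoryTheory.Over.forget S).map e.inv) := inferInstance
  rw [← CategoryTheory.Over.w e.inv]
  exact P.comp_mem _ _ (P.of_isIso ((CategoryTheory.Over.forget S).map e.inv)) h

/-! ### Residue fields and equalizers of morphisms of schemes -/

namespace AlgebraicGeometry

theorem Scheme.Hom.appLE_comp_appLE_of_eq {X Y Z : Scheme.{u}} {f : X ⟶ Y} {g : Y ⟶ Z} {t : X ⟶ Z}
    (h : f ≫ g = t) {U : Z.Opens} {V : Y.Opens} {W : X.Opens} (e₁ : V ≤ g ⁻¹ᵁ U) (e₂ : W ≤ f ⁻¹ᵁ V)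
    (e₃ : W ≤ t ⁻¹ᵁ U) : g.appLE U V e₁ ≫ f.appLE V W e₂ = t.appLE U W e₃ := by
  subst h
  exact Scheme.Hom.appLE_comp_appLE ..

/-- Stalk maps of a preimmersion are surjective, hence so are the maps on residue fields;
injectivity is automatic for fields. -/
theorem isIso_residueFieldMap_of_isPreimmersion {X Y : Scheme.{u}} (f : X ⟶ Y) [IsPreimmersion f]
    (x : X) : IsIso (f.residueFieldMap x) := by
  have hs : Function.Surjective (f.residueFieldMap x) := by
    refine Function.Surjective.of_comp (g := Y.residue (f x)) ?_
    have h2 : Function.Surjective (X.residue x ∘ f.stalkMap x) :=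
      (X.residue_surjective x).comp (f.stalkMap_surjective x)
    convert! h2
  rw [ConcreteCategory.isIso_iff_bijective]
  exact ⟨(f.residueFieldMap x).hom.injective, hs⟩

theorem exists_comp_eq_fromSpecResidueField {X Y : Scheme.{u}} (f : X ⟶ Y) [IsPreimmersion f]
    {y : Y} (hy : y ∈ Set.range f) :
    ∃ q : Spec (Y.residueField y) ⟶ X, q ≫ f = Y.fromSpecResidueField y := by
  obtain ⟨x, rfl⟩ := hy
  have := isIso_residueFieldMap_of_isPreimmersion f x
  refine ⟨Spec.map (inv (f.residueFieldMap x)) ≫ X.fromSpecResidueField x, ?_⟩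
  rw [Category.assoc, ← Scheme.Hom.SpecMap_residueFieldMap_fromSpecResidueField,
    ← Spec.map_comp_assoc]
  simp

/-- A point `y` lifts to a point with the same residue field as soon as `Spec κ(y) ⟶ Y` lifts. -/
theorem exists_isIso_residueFieldMap {X Y : Scheme.{u}} (f : X ⟶ Y) (y : Y)
    (l : Spec (Y.residueField y) ⟶ X) (hl : l ≫ f = Y.fromSpecResidueField y) :
    ∃ x : X, f x = y ∧ IsIso (f.residueFieldMap x) := by
  let pt : Spec (Y.residueField y) := default
  have hx : f (l pt) = y := by
    rw [← Scheme.Hom.comp_apply, hl, Scheme.fromSpecResidueField_apply]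
  refine ⟨l pt, hx, ?_⟩
  have h1 : IsIso ((l ≫ f).residueFieldMap pt) := by
    rw [Scheme.Hom.residueFieldMap_congr hl pt]
    have := isIso_residueFieldMap_of_isPreimmersion (Y.fromSpecResidueField y) pt
    infer_instance
  replace h1 := (ConcreteCategory.isIso_iff_bijective _).mp h1
  rw [Scheme.residueFieldMap_comp] at h1
  rw [ConcreteCategory.isIso_iff_bijective]
  -- The composite `κ(y) → κ(x) → κ(pt)` is bijective and its second map is injective, so the first
  -- is surjective.
  refine ⟨(f.residueFieldMap (l pt)).hom.injective, fun z => ?_⟩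
  obtain ⟨a, ha⟩ := h1.2 (l.residueFieldMap pt z)
  exact ⟨a, (l.residueFieldMap pt).hom.injective ha⟩

/-- Two morphisms to an unramified scheme agree on a largest subscheme, which is open. -/
theorem exists_opens_equalizer {T X Y : Scheme.{u}} (f : X ⟶ Y) [FormallyUnramified f]
    [LocallyOfFiniteType f] (a b : T ⟶ X) (hab : a ≫ f = b ≫ f) :
    ∃ U : T.Opens, U.ι ≫ a = U.ι ≫ b ∧
      ∀ {T' : Scheme.{u}} (t : T' ⟶ T), t ≫ a = t ≫ b → Set.range t ⊆ U := by
  let c : pullback (pullback.diagonal f) (pullback.lift a b hab) ⟶ T := pullback.snd _ _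
  have hc : c ≫ a = c ≫ b := by
    have h := pullback.condition (f := pullback.diagonal f) (g := pullback.lift a b hab)
    have h1 := congrArg (· ≫ pullback.fst f f) h
    have h2 := congrArg (· ≫ pullback.snd f f) h
    simp only [Category.assoc, pullback.diagonal_fst, pullback.diagonal_snd, pullback.lift_fst,
      pullback.lift_snd, Category.comp_id] at h1 h2
    exact h1.symm.trans h2
  -- `c` is a base change of the diagonal of `f`, an open immersion because `f` is unramified.
  have hoc : IsOpenImmersion c := inferInstance
  refine ⟨c.opensRange, ?_, fun {T'} t ht => ?_⟩
  · have : c.opensRange.ι = (Scheme.Hom.isoOpensRange c).inv ≫ c := by simp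
    rw [this, Category.assoc, Category.assoc, hc]
  · let l : T' ⟶ pullback (pullback.diagonal f) (pullback.lift a b hab) :=
      pullback.lift (t ≫ a) t (by
        apply pullback.hom_ext
        · rw [Category.assoc, pullback.diagonal_fst, Category.comp_id, Category.assoc,
            pullback.lift_fst]
        · rw [Category.assoc, pullback.diagonal_snd, Category.comp_id, Category.assoc,
            pullback.lift_snd, ht])
    have hl : l ≫ c = t := pullback.lift_snd _ _ _
    rintro _ ⟨x, rfl⟩
    exact ⟨l x, by rw [← Scheme.Hom.comp_apply, hl]⟩

end AlgebraicGeometry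

/-! ### Smoothness of fixed points -/

namespace EquivariantNisnevich

variable {k : Type u} [Field k] {G : Type v} [Group G]

theorem ρ_left_comp (X : GSch k G) (a b : G) :
    (X.ρ a : X.V ⟶ X.V).left ≫ (X.ρ b : X.V ⟶ X.V).left = (X.ρ (b * a) : X.V ⟶ X.V).left := by
  rw [map_mul, End.mul_def]
  rfl

theorem ρ_left_one (X : GSch k G) : (X.ρ 1 : X.V ⟶ X.V).left = 𝟙 X.V.left := by
  rw [map_one]
  rfl

instance (X : GSch k G) (g : G) : IsIso (X.ρ g : X.V ⟶ X.V).left :=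
  ⟨(X.ρ g⁻¹ : X.V ⟶ X.V).left, by rw [ρ_left_comp, inv_mul_cancel, ρ_left_one],
    by rw [ρ_left_comp, mul_inv_cancel, ρ_left_one]⟩

variable [Finite G]

/-- A point fixed by `H` has an `H`-invariant affine open neighbourhood. -/
theorem exists_invariant_isAffineOpen (H : Subgroup G) (X : GSch k G) (hX : IsSeparated X.V.hom)
    (x : X.V.left) (hx : ∀ h : H, (X.ρ h : X.V ⟶ X.V).left x = x) :
    ∃ V : X.V.left.Opens, IsAffineOpen V ∧ x ∈ V ∧
      ∀ h : H, V ≤ (X.ρ h : X.V ⟶ X.V).left ⁻¹ᵁ V := by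
  have : X.V.left.IsSeparated := by
    rw [Scheme.isSeparated_iff, ← terminal.comp_from X.V.hom]
    infer_instance
  obtain ⟨_, ⟨U, hU, rfl⟩, hxU, -⟩ :=
    X.V.left.isBasis_affineOpens.exists_subset_of_mem_open (Set.mem_univ x) isOpen_univ
  have hmem : ∀ y, y ∈ (⨅ h : H, (X.ρ h : X.V ⟶ X.V).left ⁻¹ᵁ U) ↔
      ∀ h : H, (X.ρ h : X.V ⟶ X.V).left y ∈ U := fun y => by
    rw [← SetLike.mem_coe, TopologicalSpace.Opens.coe_iInf]
    simp
  -- The intersection of the finitely many translates of `U` is affine because `X` is separated.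
  refine ⟨⨅ h : H, (X.ρ h : X.V ⟶ X.V).left ⁻¹ᵁ U, .iInf fun h => hU.preimage_of_isIso _, ?_, ?_⟩
  · exact (hmem x).2 fun h => (hx h).symm ▸ hxU
  · intro h y hy
    refine (hmem _).2 fun h' => ?_
    rw [← Scheme.Hom.comp_apply, ρ_left_comp]
    exact (hmem y).1 hy (h' * h)

/-- An equalizer of two morphisms into a separated `k`-scheme is closed, and the finite power of `X`
is separated. -/
instance isClosedImmersion_fixedPointsι (H : Subgroup G) (X : GSch k G)
    [IsSeparated X.V.hom] : IsClosedImmersion (fixedPointsι H X).left := by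
  have : MorphismProperty.ContainsIdentities (@IsSeparated.{u}) := ⟨fun _ => inferInstance⟩
  have : MorphismProperty.HasOfPostcompProperty (@IsSeparated.{u}) (@IsSeparated.{u}) :=
    ⟨fun f g _ _ => .of_comp f g⟩
  have : IsSeparated (∏ᶜ fun _ : H => X.V).hom :=
    MorphismProperty.pi_hom_mem (T := Scheme.{u}) @IsSeparated _ fun _ => inferInstance
  exact isClosedImmersion_equalizer_ι_left
    (Pi.lift fun _ : H => 𝟙 X.V) (Pi.lift fun h : H => (X.ρ h : X.V ⟶ X.V))

/-- The universal property of `X^H`, tested on affine schemes mapping into `V`, says that its ring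
of functions over `V` is the coinvariant quotient of `Γ(X, V)`; averaging then applies. -/
theorem smooth_appLE_fixedPoints [CharZero k] (H : Subgroup G) (X : GSch k G)
    [Smooth X.V.hom] [IsSeparated X.V.hom] {V : X.V.left.Opens} (hV : IsAffineOpen V)
    (hVH : ∀ h : H, V ≤ (X.ρ h : X.V ⟶ X.V).left ⁻¹ᵁ V) :
    ((fixedPoints H X).hom.appLE ⊤ ((fixedPointsι H X).left ⁻¹ᵁ V) le_top).hom.Smooth := by
  classical
  have := Fintype.ofFinite H
  let hR := isAffineOpen_top (Spec (CommRingCat.of k))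
  have hW : IsAffineOpen ((fixedPointsι H X).left ⁻¹ᵁ V) := hV.preimage _
  let W := (fixedPointsι H X).left ⁻¹ᵁ V
  let R := Γ(Spec (CommRingCat.of k), ⊤)
  let e : CommRingCat.of k ≅ R := (Scheme.ΓSpecIso (CommRingCat.of k)).symm
  let A := Γ(X.V.left, V)
  let B := Γ((fixedPoints H X).left, W)
  let ja : R ⟶ A := X.V.hom.appLE ⊤ V le_top
  let jb : R ⟶ B := (fixedPoints H X).hom.appLE ⊤ W le_top
  let : Algebra R A := ja.hom.toAlgebra
  let : Algebra R B := jb.hom.toAlgebra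
  have hA : Algebra.Smooth R A := X.V.hom.smooth_appLE hR hV le_top
  have hnoeth : IsNoetherianRing R := isNoetherianRing_of_ringEquiv k e.commRingCatIsoToRingEquiv
  have hcard : IsUnit (Fintype.card H : R) := by
    have h1 : IsUnit (Fintype.card H : k) := by simp
    simpa using h1.map e.hom.hom
  -- Pullback of functions is contravariant, which reverses the order of multiplication in `H`.
  let σ (h : H) : A →ₐ[R] A :=
    { ((X.ρ h : X.V ⟶ X.V).left.appLE V V (hVH h)).hom with
      commutes' := fun r => by
        change (ja ≫ (X.ρ h : X.V ⟶ X.V).left.appLE V V (hVH h)) r = ja r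
        exact congrArg (fun u : R ⟶ A => u r)
          (Scheme.Hom.appLE_comp_appLE_of_eq (Over.w (X.ρ h : X.V ⟶ X.V)) ..) }
  let p : A →ₐ[R] B :=
    { ((fixedPointsι H X).left.appLE V W le_rfl).hom with
      commutes' := fun r => by
        change (ja ≫ (fixedPointsι H X).left.appLE V W le_rfl) r = jb r
        exact congrArg (fun u : R ⟶ B => u r)
          (Scheme.Hom.appLE_comp_appLE_of_eq (Over.w (fixedPointsι H X)) ..) }
  have hp : Function.Surjective p := by
    have := (fixedPointsι H X).left.app_surjective V hV
    rwa [Scheme.Hom.app_eq_appLE] at this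
  have hB : Algebra.FormallySmooth R B := by
    refine .of_coinvariants hcard σ ?_ p hp ?_ ?_
    · intro h h'
      ext a
      change ((X.ρ h' : X.V ⟶ X.V).left.appLE V V (hVH h') ≫
        (X.ρ h : X.V ⟶ X.V).left.appLE V V (hVH h)) a =
          (X.ρ (h' * h : H) : X.V ⟶ X.V).left.appLE V V (hVH (h' * h)) a
      rw [Scheme.Hom.appLE_comp_appLE_of_eq (ρ_left_comp X (h : G) h')]
      rfl
    · intro h
      ext a
      change ((X.ρ h : X.V ⟶ X.V).left.appLE V V (hVH h) ≫
        (fixedPointsι H X).left.appLE V W le_rfl) a = (fixedPointsι H X).left.appLE V W le_rfl a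
      rw [Scheme.Hom.appLE_comp_appLE_of_eq
        (congrArg CommaMorphism.left (fixedPointsι_comp_ρ H X h))]
    · intro C _ _ ψ hψ
      let ψ' : A ⟶ CommRingCat.of C := CommRingCat.ofHom (R := A) (S := C) ψ.toRingHom
      let c : R ⟶ CommRingCat.of C := CommRingCat.ofHom (R := R) (S := C) (algebraMap R C)
      have hc : ja ≫ ψ' = c := by
        ext r
        exact ψ.commutes r
      let T : Sch k := Over.mk (Spec.map c ≫ hR.fromSpec)
      let t : T ⟶ X.V := Over.homMk (Spec.map ψ' ≫ hV.fromSpec) (by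
        change (Spec.map ψ' ≫ hV.fromSpec) ≫ X.V.hom = Spec.map c ≫ hR.fromSpec
        rw [Category.assoc, ← IsAffineOpen.SpecMap_appLE_fromSpec X.V.hom hR hV le_top,
          ← Spec.map_comp_assoc, ← hc])
      have ht : ∀ h : H, t ≫ (X.ρ h : X.V ⟶ X.V) = t := fun h => by
        ext1
        change (Spec.map ψ' ≫ hV.fromSpec) ≫ (X.ρ h : X.V ⟶ X.V).left =
          Spec.map ψ' ≫ hV.fromSpec
        rw [Category.assoc, ← IsAffineOpen.SpecMap_appLE_fromSpec _ hV hV (hVH h),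
          ← Spec.map_comp_assoc]
        congr 2
        ext a
        exact DFunLike.congr_fun (hψ h) a
      let l := fixedPointsLift H X t ht
      have hl : l.left ≫ (fixedPointsι H X).left = Spec.map ψ' ≫ hV.fromSpec :=
        congrArg CommaMorphism.left (fixedPointsLift_ι H X t ht)
      have hrange : Set.range l.left ⊆ Set.range hW.fromSpec := by
        rintro _ ⟨z, rfl⟩
        rw [IsAffineOpen.range_fromSpec]
        change (fixedPointsι H X).left (l.left z) ∈ (V : Set X.V.left)
        rw [← Scheme.Hom.comp_apply, hl, Scheme.Hom.comp_apply, ← hV.range_fromSpec]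
        exact Set.mem_range_self _
      obtain ⟨θ, hθ⟩ := Spec.map_surjective (IsOpenImmersion.lift hW.fromSpec l.left hrange)
      have hθl : Spec.map θ ≫ hW.fromSpec = l.left := by
        rw [hθ, IsOpenImmersion.lift_fac]
      have hpθ : (fixedPointsι H X).left.appLE V W le_rfl ≫ θ = ψ' := by
        apply Spec.map_injective
        rw [← cancel_mono hV.fromSpec, Spec.map_comp, Category.assoc,
          IsAffineOpen.SpecMap_appLE_fromSpec _ hV hW le_rfl, ← hl, ← hθl, Category.assoc]
      have hpθ' : ∀ a, θ (p a) = ψ a := fun a => congrArg (fun u : A ⟶ CommRingCat.of C => u a) hpθ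
      refine ⟨{ θ.hom with
        commutes' := fun r => ?_ }, ?_⟩
      · change θ (algebraMap R B r) = algebraMap R C r
        rw [← p.commutes, hpθ', ψ.commutes]
      · ext a
        exact hpθ' a
  -- Over the Noetherian ring `R`, finite type upgrades to finite presentation.
  have : Algebra.FiniteType R B := (inferInstance : Algebra.FiniteType R A).of_surjective p hp
  exact ⟨hB, Algebra.FinitePresentation.of_finiteType.1 this⟩

theorem IsSm.fixedPoints [CharZero k] (H : Subgroup G) {X : GSch k G} (hX : IsSm X.V) :
    IsSm (fixedPoints H X) := by
  have := hX.smooth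
  have := hX.isSeparated
  refine ⟨?_, ?_⟩
  · rw [HasRingHomProperty.iff_exists_appLE (P := @Smooth) (Q := RingHom.Smooth)]
    · intro x
      obtain ⟨V, hV, hxV, hVH⟩ := exists_invariant_isAffineOpen H X hX.isSeparated
        ((fixedPointsι H X).left x) fun h => by
          rw [← Scheme.Hom.comp_apply, ← Over.comp_left, fixedPointsι_comp_ρ]
      exact ⟨⟨⊤, isAffineOpen_top _⟩, ⟨_, hV.preimage (fixedPointsι H X).left⟩, hxV, le_top,
        smooth_appLE_fixedPoints H X hV hVH⟩
    · exact (RingHom.Smooth.stableUnderComposition.stableUnderCompositionWithLocalizationAway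
        RingHom.Smooth.holdsForLocalizationAway).1
  · rw [← Over.w (fixedPointsι H X)]
    infer_instance

/-! ### Étaleness of `f^H` and lifting of points -/

theorem fixedPointsMap_ι (H : Subgroup G) {X Y : GSch k G} (f : X ⟶ Y) :
    fixedPointsMap H f ≫ fixedPointsι H Y = fixedPointsι H X ≫ f.hom :=
  fixedPointsLift_ι _ _ _ _

/-- The fixed points of an étale equivariant morphism form an étale morphism: `X^H` is open in
`X ×_Y Y^H`. -/
theorem etale_fixedPointsMap (H : Subgroup G) {X Y : GSch k G} (f : X ⟶ Y) [Etale f.hom.left] :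
    Etale (fixedPointsMap H f).left := by
  let ι := (fixedPointsι H Y).left
  let Z := pullback f.hom.left ι
  let a : Z ⟶ X.V.left := pullback.fst _ _
  let b : Z ⟶ (fixedPoints H Y).left := pullback.snd _ _
  have hab : a ≫ f.hom.left = b ≫ ι := pullback.condition
  have hY (h : H) : ι ≫ (Y.ρ h : Y.V ⟶ Y.V).left = ι :=
    congrArg CommaMorphism.left (fixedPointsι_comp_ρ H Y h)
  have hX (h : H) : (fixedPointsι H X).left ≫ (X.ρ h : X.V ⟶ X.V).left = (fixedPointsι H X).left :=
    congrArg CommaMorphism.left (fixedPointsι_comp_ρ H X h)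
  have hf (h : H) : (X.ρ h : X.V ⟶ X.V).left ≫ f.hom.left =
      f.hom.left ≫ (Y.ρ h : Y.V ⟶ Y.V).left := congrArg CommaMorphism.left (f.comm h)
  -- `U h` is the open locus of `X ×_Y Y^H` where the projection to `X` agrees with its
  -- `h`-translate; both have the same image in `Y` because `Y^H` is fixed by `h`.
  choose U hU hUt using fun h : H => exists_opens_equalizer f.hom.left a
    (a ≫ (X.ρ h : X.V ⟶ X.V).left) (by
      rw [Category.assoc, hf, ← Category.assoc, hab, Category.assoc, hY])
  have hmem : ∀ z, z ∈ (⨅ h, U h) ↔ ∀ h, z ∈ U h := fun z => by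
    rw [← SetLike.mem_coe, TopologicalSpace.Opens.coe_iInf]
    simp
  let W : Z.Opens := ⨅ h, U h
  have hW (h : H) : (W.ι ≫ a) ≫ (X.ρ h : X.V ⟶ X.V).left = W.ι ≫ a := by
    rw [← Scheme.homOfLE_ι Z (iInf_le U h), Category.assoc, Category.assoc, Category.assoc,
      ← hU]
  let m₀ : Over.mk ((W.ι ≫ a) ≫ X.V.hom) ⟶ X.V := Over.homMk (W.ι ≫ a)
  let m₁ : Over.mk ((W.ι ≫ a) ≫ X.V.hom) ⟶ fixedPoints H X :=
    fixedPointsLift H X m₀ fun h => by ext1; exact hW h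
  let m : (W : Scheme.{u}) ⟶ (fixedPoints H X).left := m₁.left
  have hm : m ≫ (fixedPointsι H X).left = W.ι ≫ a :=
    congrArg CommaMorphism.left (fixedPointsLift_ι H X m₀ _)
  have hfι : (fixedPointsMap H f).left ≫ ι = (fixedPointsι H X).left ≫ f.hom.left :=
    congrArg CommaMorphism.left (fixedPointsMap_ι H f)
  let c : (fixedPoints H X).left ⟶ Z :=
    pullback.lift (fixedPointsι H X).left (fixedPointsMap H f).left hfι.symm
  have hca : c ≫ a = (fixedPointsι H X).left := pullback.lift_fst _ _ _
  have hcb : c ≫ b = (fixedPointsMap H f).left := pullback.lift_snd _ _ _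
  have hcW : Set.range c ⊆ Set.range W.ι := by
    rintro _ ⟨x, rfl⟩
    rw [Scheme.Opens.range_ι]
    refine (hmem _).2 fun h => hUt h c ?_ ⟨x, rfl⟩
    rw [← Category.assoc, hca, hX]
  let l := IsOpenImmersion.lift W.ι c hcW
  have hl : l ≫ W.ι = c := IsOpenImmersion.lift_fac _ _ _
  have hmono (Y : GSch k G) : Mono (fixedPointsι H Y).left :=
    inferInstanceAs (Mono ((Over.forget _).map (fixedPointsι H Y)))
  have hmonoX := hmono X
  have hmonoY : Mono ι := hmono Y
  have hmc : m ≫ c = W.ι := by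
    apply pullback.hom_ext
    · change (m ≫ c) ≫ a = W.ι ≫ a
      rw [Category.assoc, hca, hm]
    · change (m ≫ c) ≫ b = W.ι ≫ b
      rw [← cancel_mono ι, Category.assoc, Category.assoc W.ι, ← hab, Category.assoc,
        ← Category.assoc c, hca, ← Category.assoc, hm, Category.assoc]
  -- `l` and `m` identify `X^H` with the open subscheme `W`.
  have hiso : IsIso l := by
    refine ⟨m, ?_, ?_⟩
    · rw [← cancel_mono (fixedPointsι H X).left, Category.assoc, hm, ← Category.assoc, hl, hca,
        Category.id_comp]
    · rw [← cancel_mono W.ι, Category.assoc, hl, hmc, Category.id_comp]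
  rw [← hcb, ← hl]
  have : Etale b := inferInstanceAs (Etale (pullback.snd f.hom.left ι))
  infer_instance

/-- The morphism `Spec κ(y) ⟶ Y` lifts through the immersion `w`, and the section turns that lift
into a `κ(y)`-point of `X^H` over `y`. -/
theorem exists_lift_of_hasEquivariantSectionOn (H : Subgroup G) {X Y : GSch k G} (f : X ⟶ Y)
    {S : Set Y.V.left} (hS : HasEquivariantSectionOn f S) (y : (fixedPoints H Y).left)
    (hy : (fixedPointsι H Y).left y ∈ S) :
    ∃ x : (fixedPoints H X).left, (fixedPointsMap H f).left x = y ∧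
      IsIso ((fixedPointsMap H f).left.residueFieldMap x) := by
  obtain ⟨W, w, s, -, hw, rfl, hs⟩ := hS
  obtain ⟨q₀, hq₀⟩ := exists_comp_eq_fromSpecResidueField w.hom.left hy
  let κ := (fixedPoints H Y).left.fromSpecResidueField y
  let q₁ := Spec.map ((fixedPointsι H Y).left.residueFieldMap y) ≫ q₀
  have hq₁ : q₁ ≫ w.hom.left = κ ≫ (fixedPointsι H Y).left := by
    rw [Category.assoc, hq₀, Scheme.Hom.SpecMap_residueFieldMap_fromSpecResidueField]
  let T : Sch k := Over.mk (κ ≫ (fixedPoints H Y).hom)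
  let t : T ⟶ fixedPoints H Y := Over.homMk κ
  let q : T ⟶ W.V := Over.homMk q₁ (by
    change q₁ ≫ W.V.hom = κ ≫ (fixedPoints H Y).hom
    rw [← Over.w w.hom, ← Category.assoc, hq₁, Category.assoc, Over.w])
  have hq : q ≫ w.hom = t ≫ fixedPointsι H Y := by
    ext1
    exact hq₁
  have : Mono w.hom := (Over.forget _).mono_of_mono_map (inferInstanceAs (Mono w.hom.left))
  -- Invariance of `q` can be tested in `Y`, as `w` is an equivariant monomorphism.
  have hqρ (h : H) : q ≫ (W.ρ h : W.V ⟶ W.V) = q := by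
    have e : (W.ρ h : W.V ⟶ W.V) ≫ w.hom = w.hom ≫ (Y.ρ h : Y.V ⟶ Y.V) := w.comm h
    rw [← cancel_mono w.hom, Category.assoc, e, ← Category.assoc, hq, Category.assoc,
      fixedPointsι_comp_ρ]
  let l : T ⟶ fixedPoints H X := fixedPointsLift H X (q ≫ s.hom) fun h => by
    have e : (W.ρ h : W.V ⟶ W.V) ≫ s.hom = s.hom ≫ (X.ρ h : X.V ⟶ X.V) := s.comm h
    rw [Category.assoc, ← e, ← Category.assoc, hqρ]
  have hl : l ≫ fixedPointsMap H f = t := by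
    rw [← cancel_mono (fixedPointsι H Y), Category.assoc, fixedPointsMap_ι, ← Category.assoc,
      fixedPointsLift_ι, Category.assoc, ← Action.comp_hom, hs, hq]
  exact exists_isIso_residueFieldMap _ y l.left (congrArg CommaMorphism.left hl)

end EquivariantNisnevich

theorem mainTheorem6 {k : Type u} [Field k] [CharZero k] {G : Type v} [Group G] [Finite G]
    {X Y : EquivariantNisnevich.GSch k G}
    (hX : EquivariantNisnevich.IsSm X.V) (hY : EquivariantNisnevich.IsSm Y.V)
    (f : X ⟶ Y) (hf : EquivariantNisnevich.IsEquivariantNisnevichCover f) :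
    EquivariantNisnevich.IsFixedPointNisnevichCover f := by
  intro H
  have := hf.etale
  refine ⟨hX.fixedPoints H, hY.fixedPoints H,
    EquivariantNisnevich.etale_fixedPointsMap H f, fun y => ?_⟩
  obtain ⟨n, Z, h0, hn, -, -, hsec⟩ := hf.exists_splitting
  -- The chain starts at all of `Y` and ends at the empty set, so the point drops out at some step.
  obtain ⟨i, hi, hi'⟩ : ∃ i : Fin n,
      (EquivariantNisnevich.fixedPointsι H Y).left y ∈ Z i.castSucc ∧
      (EquivariantNisnevich.fixedPointsι H Y).left y ∉ Z i.succ := by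
    by_contra! hcon
    have hall : ∀ i, (EquivariantNisnevich.fixedPointsι H Y).left y ∈ Z i := fun i => by
      induction i using Fin.induction with
      | zero => rw [h0]; trivial
      | succ i ih => exact hcon i ih
    have := hall (Fin.last n)
    rw [hn] at this
    exact this
  exact EquivariantNisnevich.exists_lift_of_hasEquivariantSectionOn H f (hsec i) y ⟨hi, hi'⟩
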